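/- Let $\Sigma$ be a nonempty set (of labels). A *weak transition system* $X=(S,\mu:L\to\Sigma,T=\bigcup_{n\ge 1}T_n)$ consists of a set $S$ of states, a set $L$ of actions, a labelling map $\mu$, and sets $T_n\subset S\times L^n\times S$ of $n$-transitions ($n\ge 1$) such that - (multiset axiom) if $(\alpha,u_1,\dots,u_n,\beta)$ is a transition, then so is $(\alpha,u_{\sigma(1)},\dots,u_{\sigma(n)},\beta)$ for every permutation $\sigma$; - (patching axiom) for $n\ge 3$ and $p,q\ge 1$ with $p+q<n$, if $(\alpha,u_1,\dots,u_n,\beta)$, $(\alpha,u_1,\dots,u_p,\nu_1)$, $(\nu_1,u_{p+1},\dots,u_n,\beta)$, $(\alpha,u_1,\dots,u_{p+q},\nu_2)$ and $(\nu_2,u_{p+q+1},\dots,u_n,\beta)$ are transitions, then so is $(\nu_1,u_{p+1},\dots,u_{p+q},\nu_2)$. Maps are pairs of maps on states and on actions which preserve the labels and send transitions to transitions; the category is denoted $\mathcal{WTS}$. Its full subcategory $\mathcal{CTS}$ of *cubical* transition systems consists of the $X$ such that every action $u$ occurs in some $1$-transition $(\alpha,u,\beta)$ and such that for every transition $(\alpha,u_1,\dots,u_n,\beta)$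 with $n\ge 2$ and every $1\le p<n$ there is a state $\nu$ such that $(\alpha,u_1,\dots,u_p,\nu)$ and $(\nu,u_{p+1},\dots,u_n,\beta)$ are transitions. The full subcategory $\mathcal{RTS}\subset\mathcal{CTS}$ of *regular* transition systems consists of those for which this $\nu$ is always unique; it is reflective in $\mathcal{CTS}$, with reflection $\mathrm{CSA}_2:\mathcal{CTS}\to\mathcal{RTS}$. For a class $\mathcal{C}$ of maps of a category $\mathcal{D}$, let $\mathrm{cof}_{\mathcal{D}}(\mathcal{C})$ be the class of maps of $\mathcal{D}$ having the left lifting property with respect to every map of $\mathcal{D}$ that has the right lifting property with respect to $\mathcal{C}$. A class of maps of $\mathcal{D}$ is *cofibrantly generated* if it is equal to $\mathrm{cof}_{\mathcal{D}}(J)$ for some set $J$ of maps of $\mathcal{D}$. The *cofibrations* of $\mathcal{WTS}$ are the monomorphisms; those of $\mathcal{CTS}$ are the monomorphisms of $\mathcal{WTS}$ between cubical transition systems; those of $\mathcal{RTS}$ are the elements of $\mathrm{cof}_{\mathcal{RTS}}(\{\mathrm{CSA}_2(f) : f \text{ a cofibration of } \mathcal{CTS}\})$. Let $\mathcal{K}$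 be $\mathcal{WTS}$, $\mathcal{CTS}$ or $\mathcal{RTS}$. Let $\{\iota\}$ be the transition system with one state and no actions. A map of the comma category $\{\iota\}{\downarrow}\mathcal{K}$ is a cofibration if the underlying map of $\mathcal{K}$ is one. An object $\{\iota\}\to X$ of $\{\iota\}{\downarrow}\mathcal{K}$ is *star-shaped* if every state of $X$ can be reached from (the image of) $\iota$ by a finite, possibly empty, sequence of consecutive transitions of $X$; let $\mathcal{K}_\bullet$ be the full subcategory of star-shaped objects. **Theorem.** For each of $\mathcal{K}=\mathcal{WTS},\mathcal{CTS},\mathcal{RTS}$, the class of cofibrations of $\{\iota\}{\downarrow}\mathcal{K}$ between objects of $\mathcal{K}_\bullet$ is cofibrantly generated: there is a set $J$ of maps of $\mathcal{K}_\bullet$ such that this class is equal to $\mathrm{cof}_{\mathcal{K}_\bullet}(J)$. -/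

import Mathlib

open CategoryTheory

universe u

/-- A weak transition system over the set of labels `Lab`. The `n`-transition
`(a, u₁, …, uₙ, b)` is `Trans a [u₁, …, uₙ] b`; the lists are required to be nonempty (`n ≥ 1`). -/
structure WTS (Lab : Type u) where
  State : Type u
  Act : Type u
  label : Act → Lab
  Trans : State → List Act → State → Prop
  ne_nil : ∀ {a l b}, Trans a l b → l ≠ []
  /-- Multiset axiom. -/
  perm : ∀ {a l l' b}, l.Perm l' → Trans a l b → Trans a l' b
  /-- Patching axiom. -/
  patch : ∀ {a x y z b s t}, x ≠ [] → y ≠ [] → z ≠ [] →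
    Trans a (x ++ y ++ z) b → Trans a x s → Trans s (y ++ z) b →
    Trans a (x ++ y) t → Trans t z b → Trans s y t

namespace WTS

variable {Lab : Type u}

/-- Maps of weak transition systems. -/
@[ext]
structure Hom (X Y : WTS Lab) where
  onState : X.State → Y.State
  onAct : X.Act → Y.Act
  label_onAct : ∀ v, Y.label (onAct v) = X.label v
  map_trans : ∀ {a l b}, X.Trans a l b → Y.Trans (onState a) (l.map onAct) (onState b)

instance : Category (WTS Lab) where
  Hom := Hom
  id X :=
    { onState := id
      onAct := id
      label_onAct := fun _ => rfl
      map_trans := fun h => by simpa using h }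
  comp f g :=
    { onState := g.onState ∘ f.onState
      onAct := g.onAct ∘ f.onAct
      label_onAct := fun v => (g.label_onAct _).trans (f.label_onAct v)
      map_trans := fun h => by simpa using g.map_trans (f.map_trans h) }

/-- The one-state system `{ι}`, without actions and transitions. -/
def point (Lab : Type u) : WTS Lab where
  State := PUnit
  Act := PEmpty
  label := PEmpty.elim
  Trans _ _ _ := False
  ne_nil h := h.elim
  perm _ h := h
  patch _ _ _ h := h.elim

/-- All actions are used, and the intermediate state axiom holds. -/
structure IsCubical (X : WTS Lab) : Prop where
  act_used : ∀ v : X.Act, ∃ a b, X.Trans a [v] b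
  exists_mid : ∀ {a l m b}, l ≠ [] → m ≠ [] → X.Trans a (l ++ m) b →
    ∃ s, X.Trans a l s ∧ X.Trans s m b

/-- The unique intermediate state axiom, CSA2. -/
def CSA2 (X : WTS Lab) : Prop :=
  ∀ {a l m b}, l ≠ [] → m ≠ [] → X.Trans a (l ++ m) b →
    ∃! s, X.Trans a l s ∧ X.Trans s m b

/-- A state is reachable from `i` if a finite (possibly empty) sequence of transitions, of
arbitrary dimensions, leads from `i` to it. -/
def Reachable (X : WTS Lab) (i a : X.State) : Prop :=
  Relation.ReflTransGen (fun s t => ∃ l, X.Trans s l t) i a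

end WTS

/-- Cubical transition systems, as a full subcategory of weak transition systems. -/
abbrev CTS (Lab : Type u) : Type (u + 1) :=
  ObjectProperty.FullSubcategory (fun X : WTS Lab => X.IsCubical)

/-- The inclusion of cubical transition systems into weak transition systems. -/
abbrev CTS.toWTS (Lab : Type u) : CTS Lab ⥤ WTS Lab :=
  ObjectProperty.ι (fun X : WTS Lab => X.IsCubical)

/-- Regular transition systems, as a full subcategory of cubical transition systems. -/
abbrev RTS (Lab : Type u) : Type (u + 1) :=
  ObjectProperty.FullSubcategory (fun X : CTS Lab => X.obj.CSA2)

/-- The inclusion of regular transition systems into cubical transition systems. -/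
abbrev RTS.toCTS (Lab : Type u) : RTS Lab ⥤ CTS Lab :=
  ObjectProperty.ι (fun X : CTS Lab => X.obj.CSA2)

/-- The one-state system, as a cubical transition system. -/
def CTS.point (Lab : Type u) : CTS Lab :=
  ⟨WTS.point Lab, ⟨fun v => v.elim, fun _ _ h => h.elim⟩⟩

/-- The one-state system, as a regular transition system. -/
def RTS.point (Lab : Type u) : RTS Lab :=
  ⟨CTS.point Lab, fun _ _ h => h.elim⟩

namespace CTS

variable {Lab : Type u}

/-- Two states of `X` are identified when every map to a regular transition system
identifies them. -/
def regSetoid (X : CTS Lab) : Setoid X.obj.State where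
  r s t := ∀ (Z : RTS Lab) (f : X ⟶ Z.obj), f.hom.onState s = f.hom.onState t
  iseqv := ⟨fun _ _ _ => rfl, fun h Z f => (h Z f).symm, fun h k Z f => (h Z f).trans (k Z f)⟩

/-- The transitions on the quotient set of states: the images of the transitions of `X`, and
everything that the multiset axiom and the patching axiom generate from them. -/
inductive RegTrans (X : CTS Lab) :
    Quotient X.regSetoid → List X.obj.Act → Quotient X.regSetoid → Prop
  | image {a l b} : X.obj.Trans a l b → RegTrans X (Quotient.mk _ a) l (Quotient.mk _ b)
  | perm {a l l' b} : l.Perm l' → RegTrans X a l b → RegTrans X a l' b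
  | patch {a x y z b s t} : x ≠ [] → y ≠ [] → z ≠ [] →
      RegTrans X a (x ++ y ++ z) b → RegTrans X a x s → RegTrans X s (y ++ z) b →
      RegTrans X a (x ++ y) t → RegTrans X t z b → RegTrans X s y t

/-- The quotient of `X` which forces CSA2, as a weak transition system. -/
def regQuot (X : CTS Lab) : WTS Lab where
  State := Quotient X.regSetoid
  Act := X.obj.Act
  label := X.obj.label
  Trans := X.RegTrans
  ne_nil := by
    intro a l b h
    induction h with
    | image h => exact X.obj.ne_nil h
    | perm hp _ ih =>
      intro h
      subst h
      exact ih hp.eq_nil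
    | patch _ hy => exact hy
  perm := .perm
  patch := .patch

/-- The quotient map. -/
def toRegQuot (X : CTS Lab) : X.obj ⟶ X.regQuot where
  onState := Quotient.mk _
  onAct := id
  label_onAct _ := rfl
  map_trans {a l b} h :=
    (congrArg (fun k => X.RegTrans (Quotient.mk _ a) k (Quotient.mk _ b)) (List.map_id l)).mpr
      (RegTrans.image h)

/-- The map induced on the quotient set of states by a map to a regular transition system. -/
def regLiftState (X : CTS Lab) (Z : RTS Lab) (f : X ⟶ Z.obj) :
    Quotient X.regSetoid → Z.obj.obj.State :=
  Quotient.lift f.hom.onState (fun _ _ h => h Z f)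

theorem regLift_trans (X : CTS Lab) (Z : RTS Lab) (f : X ⟶ Z.obj)
    {a b : Quotient X.regSetoid} {l : List X.obj.Act} (h : X.RegTrans a l b) :
    Z.obj.obj.Trans (regLiftState X Z f a) (l.map f.hom.onAct) (regLiftState X Z f b) := by
  induction h with
  | image h => exact f.hom.map_trans h
  | perm hp _ ih => exact Z.obj.obj.perm (hp.map _) ih
  | @patch a x y z b s t hx hy hz _ _ _ _ _ h1 h2 h3 h4 h5 =>
    rw [List.map_append] at h1 h3 h4
    rw [List.map_append] at h1
    exact Z.obj.obj.patch (mt List.map_eq_nil_iff.1 hx) (mt List.map_eq_nil_iff.1 hy)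
      (mt List.map_eq_nil_iff.1 hz) h1 h2 h3 h4 h5

/-- Maps to regular transition systems factor through the quotient. -/
def regLift (X : CTS Lab) (Z : RTS Lab) (f : X ⟶ Z.obj) : X.regQuot ⟶ Z.obj.obj where
  onState := regLiftState X Z f
  onAct := f.hom.onAct
  label_onAct := f.hom.label_onAct
  map_trans h := X.regLift_trans Z f h

theorem regQuot_exists_mid (X : CTS Lab) {a b : Quotient X.regSetoid} {w : List X.obj.Act}
    (h : X.RegTrans a w b) : ∀ {l m}, l ≠ [] → m ≠ [] → w.Perm (l ++ m) →
      ∃ s, X.RegTrans a l s ∧ X.RegTrans s m b := by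
  induction h with
  | image h =>
    intro l m hl hm hp
    obtain ⟨s, h1, h2⟩ := X.property.exists_mid hl hm (X.obj.perm hp h)
    exact ⟨_, .image h1, .image h2⟩
  | perm hq _ ih =>
    intro l m hl hm hp
    exact ih hl hm (hq.trans hp)
  | @patch a x y z b s t hx hy hz h1 h2 h3 h4 h5 ih1 _ _ _ _ =>
    intro l m hl hm hp
    have hp' : (x ++ y ++ z).Perm ((x ++ l) ++ (m ++ z)) := by
      have := (hp.append_left x).append_right z
      simpa [List.append_assoc] using this
    obtain ⟨c, k1, k2⟩ := ih1 (l := x ++ l) (m := m ++ z) (by simp [hl]) (by simp [hm]) hp'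
    have hsb : X.RegTrans s (l ++ (m ++ z)) b := by
      refine .perm ?_ h3
      have := hp.append_right z
      simpa [List.append_assoc] using this
    have hat : X.RegTrans a ((x ++ l) ++ m) t := by
      refine .perm ?_ h4
      have := hp.append_left x
      simpa [List.append_assoc] using this
    refine ⟨c, ?_, ?_⟩
    · exact .patch hx hl (by simp [hm]) (.perm hp' h1) h2 hsb k1 k2
    · refine .patch (x := x ++ l) (by simp [hl]) hm hz ?_ k1 k2 hat h5
      refine .perm ?_ h1
      simpa [List.append_assoc] using hp'

theorem regQuot_mid_unique (X : CTS Lab) {a b s t : Quotient X.regSetoid}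
    {l m : List X.obj.Act} (hl : l ≠ []) (hm : m ≠ []) (h : X.RegTrans a (l ++ m) b)
    (h1 : X.RegTrans a l s) (h2 : X.RegTrans s m b)
    (k1 : X.RegTrans a l t) (k2 : X.RegTrans t m b) : t = s := by
  induction s using Quotient.inductionOn with | _ s
  induction t using Quotient.inductionOn with | _ t
  refine Quotient.sound (fun Z f => ?_)
  have hZ := X.regLift_trans Z f h
  rw [List.map_append] at hZ
  exact (Z.property (mt List.map_eq_nil_iff.1 hl) (mt List.map_eq_nil_iff.1 hm) hZ).unique
    ⟨X.regLift_trans Z f k1, X.regLift_trans Z f k2⟩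
    ⟨X.regLift_trans Z f h1, X.regLift_trans Z f h2⟩

/-- The quotient is a regular transition system. -/
def regular (X : CTS Lab) : RTS Lab :=
  ⟨⟨X.regQuot,
    { act_used := fun v => by
        obtain ⟨a, b, h⟩ := X.property.act_used v
        exact ⟨_, _, .image h⟩
      exists_mid := fun hl hm h => X.regQuot_exists_mid h hl hm (.refl _) }⟩, by
    intro a l m b hl hm h
    obtain ⟨s, h1, h2⟩ := X.regQuot_exists_mid h hl hm (.refl _)
    exact ⟨s, ⟨h1, h2⟩, fun t k => X.regQuot_mid_unique hl hm h h1 h2 k.1 k.2⟩⟩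

/-- The universal property of the quotient. -/
def regularEquiv (X : CTS Lab) (Z : RTS Lab) :
    (X.regular ⟶ Z) ≃ (X ⟶ (RTS.toCTS Lab).obj Z) where
  toFun g := ObjectProperty.homMk (X.toRegQuot ≫ g.hom.hom)
  invFun f := ObjectProperty.homMk (ObjectProperty.homMk (X.regLift Z f))
  left_inv g := by
    apply ObjectProperty.hom_ext
    apply ObjectProperty.hom_ext
    refine WTS.Hom.ext ?_ rfl
    funext s
    induction s using Quotient.inductionOn
    rfl
  right_inv f := rfl

/-- The reflection of cubical transition systems onto regular ones. -/
def reflection (Lab : Type u) : CTS Lab ⥤ RTS Lab :=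
  Adjunction.leftAdjointOfEquiv (G := RTS.toCTS Lab) (F_obj := regular) regularEquiv
    (fun _ _ _ _ _ => rfl)

/-- The reflection is left adjoint to the inclusion. -/
def reflectionAdj (Lab : Type u) : reflection Lab ⊣ RTS.toCTS Lab :=
  Adjunction.adjunctionOfEquivLeft _ _

end CTS

/-- Cofibrations of weak transition systems: the monomorphisms. -/
def WTS.cofibrations (Lab : Type u) : MorphismProperty (WTS Lab) :=
  MorphismProperty.monomorphisms (WTS Lab)

/-- Cofibrations of cubical transition systems: the monomorphisms of weak transition systems
between cubical transition systems. -/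
def CTS.cofibrations (Lab : Type u) : MorphismProperty (CTS Lab) :=
  (WTS.cofibrations Lab).inverseImage (CTS.toWTS Lab)

/-- Cofibrations of regular transition systems: the class generated, through lifting properties
in the category of regular transition systems, by the reflections of the cofibrations of cubical
transition systems. -/
def RTS.cofibrations (Lab : Type u) : MorphismProperty (RTS Lab) :=
  ((CTS.cofibrations Lab).map (CTS.reflection Lab)).rlp.llp

/-- The objects `{ι} → X` of `{ι} ↓ WTS` all of whose states are reachable from the image of `ι`. -/
def WTS.starShaped (Lab : Type u) : ObjectProperty (Under (WTS.point Lab)) := fun X =>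
  ∀ a : X.right.State, X.right.Reachable (X.hom.onState PUnit.unit) a

/-- The objects `{ι} → X` of `{ι} ↓ CTS` all of whose states are reachable from the image of `ι`. -/
def CTS.starShaped (Lab : Type u) : ObjectProperty (Under (CTS.point Lab)) := fun X =>
  ∀ a : X.right.obj.State, X.right.obj.Reachable (X.hom.hom.onState PUnit.unit) a

/-- The objects `{ι} → X` of `{ι} ↓ RTS` all of whose states are reachable from the image of `ι`. -/
def RTS.starShaped (Lab : Type u) : ObjectProperty (Under (RTS.point Lab)) := fun X =>
  ∀ a : X.right.obj.obj.State,
    X.right.obj.obj.Reachable (X.hom.hom.hom.onState PUnit.unit) a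

/-- Given a class `C` of maps of `K` and a class `P` of objects of `p ↓ K`, the maps of the full
subcategory of `p ↓ K` on `P` whose underlying map belongs to `C`. -/
def underCofibrations {K : Type (u + 1)} [Category.{u} K] (C : MorphismProperty K) {p : K}
    (P : ObjectProperty (Under p)) : MorphismProperty P.FullSubcategory :=
  C.inverseImage (P.ι ⋙ Under.forget p)

/-- A class of maps of `D` is cofibrantly generated if it is `cof(J)` for a set `J` of maps of `D`:
the maps with the left lifting property against every map which has the right lifting property
against `J`. -/
def IsCofibrantlyGeneratedClass {D : Type (u + 1)} [Category.{u} D]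
    (C : MorphismProperty D) : Prop :=
  ∃ J : MorphismProperty D, MorphismProperty.IsSmall.{u} J ∧ C = J.rlp.llp

/-! A monomorphism of weak transition systems is a map that is injective on states and on actions.
The maps called trivial fibrations here are surjective on states and actions and reflect
transitions. They lift on the right against every injective map: a lift is chosen as a map of sets,
and labels and transitions then take care of themselves (`IsTrivFib.hasLiftingProperty`).

For `WTS` and `CTS`, the generators are the based injections between star-shaped systems (cubical
ones for `CTS`) whose states and actions form subsets of ℕ. They suffice because any countable data
in a star-shaped system lies in a countable star-shaped part, cubical if the whole system is
(`exists_countable_part`). A map lifting against the generators is thus a trivial fibration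
(`isTrivFib_of_lift`). Conversely, each map of star-shaped objects factors as an injection `i`
followed by a trivial fibration, without leaving the category (`exists_factorization`). If `f` lifts
against that trivial fibration, then `f ≫ k = i` for some `k`, so `f` is injective.

For `RTS`, monomorphisms play no role: the generators are the reflections of those of `CTS`. By
adjunction, lifting against them amounts to being a trivial fibration of underlying cubical systems,
which gives one inclusion. For the other, a lifting problem with star-shaped source in `RTS` only
sees the states reachable from the image of the base point, so the map on the right may be replaced
by the induced map of reachable parts (`reachStarMap_rlp`). -/

namespace WTS

variable {Lab : Type u}

/-! ### Injective maps, trivial fibrations and pulled back structures -/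

@[simp]
theorem comp_onState {X Y Z : WTS Lab} (f : X ⟶ Y) (g : Y ⟶ Z) (s : X.State) :
    (f ≫ g).onState s = g.onState (f.onState s) := rfl

theorem hom_ext {X Y : WTS Lab} {f g : X ⟶ Y} (hs : ∀ s, f.onState s = g.onState s)
    (ha : ∀ v, f.onAct v = g.onAct v) : f = g :=
  Hom.ext (funext hs) (funext ha)

/-- The map from the one-state system which picks a state. -/
def fromPoint (X : WTS Lab) (s : X.State) : point Lab ⟶ X where
  onState _ := s
  onAct := PEmpty.elim
  label_onAct v := v.elim
  map_trans h := h.elim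

theorem point_hom_ext {X : WTS Lab} {f g : point Lab ⟶ X}
    (h : f.onState PUnit.unit = g.onState PUnit.unit) : f = g :=
  hom_ext (fun _ => h) (fun v => v.elim)

/-- The system without states whose only action has a given label. -/
def singleAct (x : Lab) : WTS Lab where
  State := PEmpty
  Act := PUnit
  label _ := x
  Trans _ _ _ := False
  ne_nil h := h.elim
  perm _ h := h
  patch _ _ _ h := h.elim

/-- The map which picks an action. -/
def fromSingleAct (X : WTS Lab) (v : X.Act) (x : Lab) (h : X.label v = x) :
    singleAct x ⟶ X where
  onState := PEmpty.elim
  onAct _ := v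
  label_onAct _ := h
  map_trans h := h.elim

/-- A map is injective if it is so on states and on actions. -/
structure IsInj {X Y : WTS Lab} (f : X ⟶ Y) : Prop where
  state : Function.Injective f.onState
  act : Function.Injective f.onAct

/-- The one-state system represents states, and the stateless one-action systems represent actions
with a given label. Two actions with the same image have the same label, so they can be tested by
the same system. -/
theorem isInj_of_mono {X Y : WTS Lab} (f : X ⟶ Y) [Mono f] : IsInj f where
  state s t h := by
    have : X.fromPoint s = X.fromPoint t := by
      rw [← cancel_mono f]
      exact point_hom_ext h
    exact congrArg (fun g : point Lab ⟶ X => g.onState PUnit.unit) this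
  act v w h := by
    have hl : X.label v = X.label w := by
      rw [← f.label_onAct v, ← f.label_onAct w, h]
    have : X.fromSingleAct v _ hl = X.fromSingleAct w _ rfl := by
      rw [← cancel_mono f]
      exact hom_ext (fun s => s.elim) (fun _ => h)
    exact congrArg (fun g : singleAct (X.label w) ⟶ X => g.onAct PUnit.unit) this

theorem IsInj.mono {X Y : WTS Lab} {f : X ⟶ Y} (hf : IsInj f) : Mono f where
  right_cancellation g h e := by
    refine hom_ext (fun s => hf.state ?_) (fun v => hf.act ?_)
    · exact congrArg (fun k : _ ⟶ Y => k.onState s) e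
    · exact congrArg (fun k : _ ⟶ Y => k.onAct v) e

theorem mono_iff_isInj {X Y : WTS Lab} (f : X ⟶ Y) : Mono f ↔ IsInj f :=
  ⟨fun _ => isInj_of_mono f, IsInj.mono⟩

theorem IsInj.of_comp {X Y Z : WTS Lab} {f : X ⟶ Y} {g : Y ⟶ Z} (h : IsInj (f ≫ g)) :
    IsInj f :=
  ⟨Function.Injective.of_comp h.state, Function.Injective.of_comp h.act⟩

/-- A map which is surjective on states and on actions, and reflects transitions. -/
structure IsTrivFib {X Y : WTS Lab} (p : X ⟶ Y) : Prop where
  state : Function.Surjective p.onState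
  act : Function.Surjective p.onAct
  reflect : ∀ {a l b}, Y.Trans (p.onState a) (l.map p.onAct) (p.onState b) → X.Trans a l b

/-- On the image of `g` the lift is forced by `t`; elsewhere any preimage under `p` will do. -/
theorem exists_lift_of_injective {A B E D : Type*} {g : A → B} (hg : Function.Injective g)
    {p : E → D} (hp : Function.Surjective p) {t : A → E} {b : B → D}
    (h : ∀ x, p (t x) = b (g x)) : ∃ k : B → E, (∀ x, k (g x) = t x) ∧ ∀ y, p (k y) = b y := by
  classical
  refine ⟨fun y => if hy : ∃ x, g x = y then t hy.choose else (hp (b y)).choose,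
    fun x => ?_, fun y => ?_⟩
  · have hx : ∃ x', g x' = g x := ⟨x, rfl⟩
    simp only [dif_pos hx]
    rw [hg hx.choose_spec]
  · by_cases hy : ∃ x, g x = y
    · simp only [dif_pos hy]
      rw [h, hy.choose_spec]
    · simp only [dif_neg hy]
      exact (hp (b y)).choose_spec

theorem IsTrivFib.hasLiftingProperty {A B E D : WTS Lab} {g : A ⟶ B} {p : E ⟶ D}
    (hp : IsTrivFib p) (hg : IsInj g) : HasLiftingProperty g p where
  sq_hasLift {t b} sq := by
    have hS : ∀ x, p.onState (t.onState x) = b.onState (g.onState x) := fun x =>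
      congrArg (fun k : A ⟶ D => k.onState x) sq.w
    have hA : ∀ x, p.onAct (t.onAct x) = b.onAct (g.onAct x) := fun x =>
      congrArg (fun k : A ⟶ D => k.onAct x) sq.w
    obtain ⟨kS, hS1, hS2⟩ := exists_lift_of_injective hg.state hp.state hS
    obtain ⟨kA, hA1, hA2⟩ := exists_lift_of_injective hg.act hp.act hA
    refine ⟨⟨⟨{ onState := kS, onAct := kA, label_onAct := fun v => ?_,
                map_trans := fun {a l c} h => hp.reflect ?_ }, ?_, ?_⟩⟩⟩
    -- Since `p` preserves labels, the label of a lifted action can be read off after applying `p`.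
    · rw [← p.label_onAct, hA2, b.label_onAct]
    · have e : (l.map kA).map p.onAct = l.map b.onAct := by
        rw [List.map_map]
        exact List.map_congr_left fun v _ => hA2 v
      rw [hS2, hS2, e]
      exact b.map_trans h
    · exact hom_ext hS1 hA1
    · exact hom_ext hS2 hA2

theorem Reachable.map {X Y : WTS Lab} (f : X ⟶ Y) {a b : X.State} (h : X.Reachable a b) :
    Y.Reachable (f.onState a) (f.onState b) :=
  Relation.ReflTransGen.lift (r := fun s t => ∃ l, X.Trans s l t) f.onState
    (fun _ _ ⟨_, hl⟩ => ⟨_, f.map_trans hl⟩) _ _ h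

/-- The system whose structure is pulled back along a pair of maps. -/
def pull (X : WTS Lab) {S U : Type u} (φ : S → X.State) (ψ : U → X.Act) : WTS Lab where
  State := S
  Act := U
  label v := X.label (ψ v)
  Trans a l b := X.Trans (φ a) (l.map ψ) (φ b)
  ne_nil h e := X.ne_nil h (by rw [e, List.map_nil])
  perm hp h := X.perm (hp.map ψ) h
  patch hx hy hz h1 h2 h3 h4 h5 := by
    simp only [List.map_append] at h1 h3 h4
    exact X.patch (mt List.map_eq_nil_iff.1 hx) (mt List.map_eq_nil_iff.1 hy)
      (mt List.map_eq_nil_iff.1 hz) h1 h2 h3 h4 h5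

theorem pull_trans_append {X : WTS Lab} {S U : Type u} {φ : S → X.State} {ψ : U → X.Act}
    {a b : S} {l m : List U} (h : (X.pull φ ψ).Trans a (l ++ m) b) :
    X.Trans (φ a) (l.map ψ ++ m.map ψ) (φ b) := by
  rw [← List.map_append]
  exact h

/-- The canonical map from a pulled back structure. -/
def pullHom (X : WTS Lab) {S U : Type u} (φ : S → X.State) (ψ : U → X.Act) :
    X.pull φ ψ ⟶ X where
  onState := φ
  onAct := ψ
  label_onAct _ := rfl
  map_trans h := h

/-- Maps to a pulled back structure. -/
def pullLift {X Y : WTS Lab} {S U : Type u} (φ : S → X.State) (ψ : U → X.Act) (f : Y ⟶ X)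
    (kS : Y.State → S) (kA : Y.Act → U) (hS : ∀ s, φ (kS s) = f.onState s)
    (hA : ∀ v, ψ (kA v) = f.onAct v) : Y ⟶ X.pull φ ψ where
  onState := kS
  onAct := kA
  label_onAct v := by
    rw [← f.label_onAct, ← hA]
    rfl
  map_trans {a l b} h := by
    have e : (l.map kA).map ψ = l.map f.onAct := by
      rw [List.map_map]
      exact List.map_congr_left fun v _ => hA v
    change X.Trans (φ (kS a)) ((l.map kA).map ψ) (φ (kS b))
    rw [hS, hS, e]
    exact f.map_trans h

/-- The map between the structures pulled back from the source and the target of a map. -/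
def pullMap {X Y : WTS Lab} (p : X ⟶ Y) {S U : Type u} (φ : S → X.State) (ψ : U → X.Act) :
    X.pull φ ψ ⟶ Y.pull (p.onState ∘ φ) (p.onAct ∘ ψ) :=
  pullLift _ _ (X.pullHom φ ψ ≫ p) id id (fun _ => rfl) (fun _ => rfl)

theorem pullMap_isInj {X Y : WTS Lab} (p : X ⟶ Y) {S U : Type u} (φ : S → X.State)
    (ψ : U → X.Act) : IsInj (pullMap p φ ψ) :=
  ⟨fun _ _ h => h, fun _ _ h => h⟩

theorem pull_isCubical {X : WTS Lab} {S U : Type u} {φ : S → X.State} {ψ : U → X.Act}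
    (hu : ∀ v, ∃ a b, X.Trans (φ a) [ψ v] (φ b))
    (hm : ∀ a l m b, l ≠ [] → m ≠ [] → X.Trans (φ a) (l.map ψ ++ m.map ψ) (φ b) →
      ∃ s, X.Trans (φ a) (l.map ψ) (φ s) ∧ X.Trans (φ s) (m.map ψ) (φ b)) :
    (X.pull φ ψ).IsCubical where
  act_used := hu
  exists_mid {a l m b} hl hm' h := hm a l m b hl hm' (pull_trans_append h)

/-- A path on which all states and all actions are in the image of the carriers lifts. -/
theorem pull_reachable {X : WTS Lab} {S U : Type u} {φ : S → X.State}
    (hφ : Function.Injective φ) {ψ : U → X.Act} {s₀ : S} {c : X.State}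
    (h : Relation.ReflTransGen (fun s t => s ∈ Set.range φ ∧ t ∈ Set.range φ ∧
      ∃ l, (∀ v ∈ l, v ∈ Set.range ψ) ∧ X.Trans s l t) (φ s₀) c) :
    ∀ a, φ a = c → (X.pull φ ψ).Reachable s₀ a := by
  induction h with
  | refl =>
    intro a ha
    rw [hφ ha]
    exact .refl
  | tail _ h ih =>
    rintro a rfl
    obtain ⟨⟨s, rfl⟩, -, l, hl, h⟩ := h
    obtain ⟨l, rfl⟩ : l ∈ Set.range (List.map ψ) := by
      rw [Set.range_list_map]
      exact hl
    exact (ih s rfl).tail ⟨l, h⟩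

/-! ### The reachable part -/

/-- The part of `X` which is reachable from `i`. -/
def reach (X : WTS Lab) (i : X.State) : WTS Lab :=
  X.pull (S := {a // X.Reachable i a})
    (U := {v // ∃ a b, X.Reachable i a ∧ X.Trans a [v] b}) Subtype.val Subtype.val

/-- The inclusion of the reachable part. -/
def reachHom (X : WTS Lab) (i : X.State) : X.reach i ⟶ X := X.pullHom _ _

/-- The multiset axiom moves `v` to the front, and the intermediate state axiom cuts the word after
it, unless nothing remains. -/
theorem IsCubical.exists_trans_of_mem {X : WTS Lab} (hX : X.IsCubical) {a b : X.State}
    {l : List X.Act} (h : X.Trans a l b) {v : X.Act} (hv : v ∈ l) : ∃ s, X.Trans a [v] s := by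
  classical
  have hp : l.Perm ([v] ++ l.erase v) := List.perm_cons_erase hv
  by_cases he : l.erase v = []
  · rw [he] at hp
    exact ⟨b, X.perm hp h⟩
  · obtain ⟨s, hs, -⟩ := hX.exists_mid (by simp) he (X.perm hp h)
    exact ⟨s, hs⟩

theorem reach_reachable {X : WTS Lab} (hX : X.IsCubical) (i : X.State) (a : (X.reach i).State) :
    (X.reach i).Reachable ⟨i, .refl⟩ a := by
  obtain ⟨c, hc⟩ := a
  refine pull_reachable (X := X) Subtype.val_injective (s₀ := ⟨i, .refl⟩) (c := c) ?_ ⟨c, hc⟩ rfl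
  induction hc with
  | refl => exact .refl
  | tail hb h ih =>
    obtain ⟨l, h⟩ := h
    refine ih.tail ⟨⟨⟨_, hb⟩, rfl⟩, ⟨⟨_, hb.tail ⟨l, h⟩⟩, rfl⟩, l, fun v hv => ?_, h⟩
    -- The reachable part keeps only the actions of 1-transitions that start at a reachable state;
    -- cubicality ensures that the actions along a path are among them.
    obtain ⟨s, hs⟩ := hX.exists_trans_of_mem h hv
    exact ⟨⟨v, _, s, hb, hs⟩, rfl⟩

theorem reach_isCubical {X : WTS Lab} (hX : X.IsCubical) (i : X.State) :
    (X.reach i).IsCubical := by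
  refine pull_isCubical ?_ ?_
  · rintro ⟨v, a, b, ha, h⟩
    exact ⟨⟨a, ha⟩, ⟨b, ha.tail ⟨_, h⟩⟩, h⟩
  · rintro ⟨a, ha⟩ l m b hl hm h
    obtain ⟨s, h1, h2⟩ := hX.exists_mid (mt List.map_eq_nil_iff.1 hl)
      (mt List.map_eq_nil_iff.1 hm) h
    exact ⟨⟨s, ha.tail ⟨_, h1⟩⟩, h1, h2⟩

theorem reach_csa2 {X : WTS Lab} (hX : X.IsCubical) (h2 : X.CSA2) (i : X.State) :
    (X.reach i).CSA2 := by
  intro a l m b hl hm h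
  obtain ⟨s, hs⟩ := (reach_isCubical hX i).exists_mid hl hm h
  refine ⟨s, hs, fun t ht => Subtype.ext ?_⟩
  exact (h2 (mt List.map_eq_nil_iff.1 hl) (mt List.map_eq_nil_iff.1 hm)
    (pull_trans_append h)).unique ht hs

/-- A map from a star-shaped cubical system factors through the reachable part. -/
def reachLift {A X : WTS Lab} (hA : A.IsCubical) {a₀ : A.State} (ha : ∀ a, A.Reachable a₀ a)
    (f : A ⟶ X) {i : X.State} (hi : f.onState a₀ = i) : A ⟶ X.reach i :=
  pullLift _ _ f (fun s => ⟨f.onState s, hi ▸ (ha s).map f⟩)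
    (fun v => ⟨f.onAct v, by
      obtain ⟨a, b, h⟩ := hA.act_used v
      exact ⟨_, _, hi ▸ (ha a).map f, f.map_trans h⟩⟩) (fun _ => rfl) (fun _ => rfl)

/-- The map induced on reachable parts. -/
def reachMap {X Y : WTS Lab} (f : X ⟶ Y) {i : X.State} {j : Y.State} (h : f.onState i = j) :
    X.reach i ⟶ Y.reach j :=
  pullLift _ _ (X.reachHom i ≫ f) (fun s => ⟨f.onState s.1, h ▸ s.2.map f⟩)
    (fun v => ⟨f.onAct v.1, by
      obtain ⟨a, b, ha, hv⟩ := v.2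
      exact ⟨_, _, h ▸ ha.map f, f.map_trans hv⟩⟩) (fun _ => rfl) (fun _ => rfl)

theorem reachHom_isInj (X : WTS Lab) (i : X.State) : IsInj (X.reachHom i) :=
  ⟨Subtype.val_injective, Subtype.val_injective⟩

/-! ### Factorization of a map into an injective map and a trivial fibration -/

/-- The graph of `f` embeds `X` in a product with `Y` whose transitions are decided by the second
coordinate alone. The projection to `Y` then reflects transitions, and it still does after
restriction to the reachable pairs. -/
theorem exists_factorization {X Y : WTS Lab} (f : X ⟶ Y) {x₀ : X.State}
    (hX : ∀ x, X.Reachable x₀ x) (hY : ∀ y, Y.Reachable (f.onState x₀) y) :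
    ∃ (W : WTS Lab) (i : X ⟶ W) (q : W ⟶ Y), i ≫ q = f ∧ IsInj i ∧ IsTrivFib q ∧
      (∀ w, W.Reachable (i.onState x₀) w) ∧ (Y.IsCubical → W.IsCubical) := by
  -- The extra action `none` keeps the projection surjective on actions even if `X` has none; for
  -- states, `x₀` plays this role.
  let P : WTS Lab := Y.pull (S := X.State × Y.State) (U := Option X.Act × Y.Act) Prod.snd Prod.snd
  let pt : P.State := (x₀, f.onState x₀)
  let j : X ⟶ P := pullLift _ _ f (fun x => (x, f.onState x)) (fun v => (some v, f.onAct v))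
    (fun _ => rfl) (fun _ => rfl)
  -- This section of the projection carries paths of `Y` to `P`, which makes every `(x₀, y)`
  -- reachable.
  let sec : Y ⟶ P := pullLift _ _ (𝟙 Y) (fun y => (x₀, y)) (fun v => (none, v))
    (fun _ => rfl) (fun _ => rfl)
  have hsec : ∀ y, P.Reachable pt (x₀, y) := fun y => (hY y).map sec
  let W : WTS Lab := P.pull (S := {w // P.Reachable pt w}) (U := P.Act) Subtype.val id
  let i : X ⟶ W := pullLift _ _ j (fun x => ⟨j.onState x, (hX x).map j⟩) j.onAct
    (fun _ => rfl) (fun _ => rfl)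
  refine ⟨W, i, P.pullHom _ _ ≫ Y.pullHom _ _, rfl, ⟨?_, ?_⟩, ⟨?_, ?_, ?_⟩, ?_, ?_⟩
  · intro x y h
    exact congrArg Prod.fst (congrArg Subtype.val h)
  · intro v w h
    exact Option.some_injective _ (congrArg Prod.fst h)
  · exact fun y => ⟨⟨(x₀, y), hsec y⟩, rfl⟩
  · exact fun v => ⟨(none, v), rfl⟩
  · intro a l b h
    change Y.Trans a.1.2 ((l.map id).map Prod.snd) b.1.2
    rw [List.map_id]
    exact h
  · rintro ⟨c, hc⟩
    refine pull_reachable (X := P) Subtype.val_injective (s₀ := ⟨pt, .refl⟩) (c := c) ?_ ⟨c, hc⟩ rfl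
    induction hc with
    | refl => exact .refl
    | tail hb h ih =>
      obtain ⟨l, h⟩ := h
      exact ih.tail ⟨⟨⟨_, hb⟩, rfl⟩, ⟨⟨_, hb.tail ⟨l, h⟩⟩, rfl⟩, l, fun v _ => ⟨v, rfl⟩, h⟩
  · intro hc
    refine pull_isCubical ?_ ?_
    · rintro ⟨x, v⟩
      obtain ⟨a, b, h⟩ := hc.act_used v
      exact ⟨⟨(x₀, a), hsec a⟩, ⟨(x₀, b), hsec b⟩, h⟩
    · rintro ⟨a, ha⟩ l m b hl hm h
      rw [List.map_id, List.map_id] at h ⊢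
      obtain ⟨s, h1, h2⟩ := hc.exists_mid (mt List.map_eq_nil_iff.1 hl)
        (mt List.map_eq_nil_iff.1 hm) (pull_trans_append h)
      -- The first coordinate of an intermediate state is arbitrary, so `x₀` is allowed.
      have h1' : P.Trans a l (x₀, s) := h1
      exact ⟨⟨(x₀, s), ha.tail ⟨_, h1'⟩⟩, h1, h2⟩

end WTS

/-! ### Countable closed subsets -/

theorem Set.Countable.setOf_list {β : Type*} {U : Set β} (hU : U.Countable) :
    {l : List β | ∀ v ∈ l, v ∈ U}.Countable := by
  have := hU.to_subtype
  rw [← Set.range_list_map_coe]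
  exact Set.countable_range _

/-- Closure of a pair of countable sets under a countably branching operation. -/
theorem exists_countable_closed {α β : Type*} (F : α → List β → List β → α → Set α)
    (G : α → List β → List β → α → Set β) (hF : ∀ a l m b, (F a l m b).Countable)
    (hG : ∀ a l m b, (G a l m b).Countable) {S₀ : Set α} {U₀ : Set β} (hS : S₀.Countable)
    (hU : U₀.Countable) : ∃ (S : Set α) (U : Set β), S.Countable ∧ U.Countable ∧ S₀ ⊆ S ∧ U₀ ⊆ U ∧
      ∀ a ∈ S, ∀ b ∈ S, ∀ l m, (∀ v ∈ l, v ∈ U) → (∀ v ∈ m, v ∈ U) →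
        F a l m b ⊆ S ∧ G a l m b ⊆ U := by
  let Q : Set α × Set β → Set (α × List β × List β × α) := fun D =>
    D.1 ×ˢ {l | ∀ v ∈ l, v ∈ D.2} ×ˢ {l | ∀ v ∈ l, v ∈ D.2} ×ˢ D.1
  let D : ℕ → Set α × Set β := fun n => Nat.rec (S₀, U₀) (fun _ E =>
    (E.1 ∪ ⋃ q ∈ Q E, F q.1 q.2.1 q.2.2.1 q.2.2.2,
      E.2 ∪ ⋃ q ∈ Q E, G q.1 q.2.1 q.2.2.1 q.2.2.2)) n
  have hD : ∀ n, (D n).1.Countable ∧ (D n).2.Countable := by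
    intro n
    induction n with
    | zero => exact ⟨hS, hU⟩
    | succ n ih =>
      have hQ : (Q (D n)).Countable :=
        ih.1.prod (ih.2.setOf_list.prod (ih.2.setOf_list.prod ih.1))
      exact ⟨ih.1.union (hQ.biUnion fun _ _ => hF _ _ _ _),
        ih.2.union (hQ.biUnion fun _ _ => hG _ _ _ _)⟩
  have hm1 : Monotone fun n => (D n).1 := monotone_nat_of_le_succ fun _ => Set.subset_union_left
  have hm2 : Monotone fun n => (D n).2 := monotone_nat_of_le_succ fun _ => Set.subset_union_left
  have hlist : ∀ l : List β, (∀ v ∈ l, v ∈ ⋃ n, (D n).2) → ∃ n, ∀ v ∈ l, v ∈ (D n).2 := by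
    intro l
    induction l with
    | nil => exact fun _ => ⟨0, by simp⟩
    | cons v l ih =>
      intro h
      obtain ⟨n, hn⟩ := ih fun w hw => h w (List.mem_cons_of_mem _ hw)
      obtain ⟨k, hk⟩ := Set.mem_iUnion.1 (h v List.mem_cons_self)
      refine ⟨max n k, fun w hw => ?_⟩
      rcases List.mem_cons.1 hw with rfl | hw
      · exact hm2 (le_max_right _ _) hk
      · exact hm2 (le_max_left _ _) (hn w hw)
  refine ⟨⋃ n, (D n).1, ⋃ n, (D n).2, Set.countable_iUnion fun n => (hD n).1,
    Set.countable_iUnion fun n => (hD n).2, Set.subset_iUnion (fun n => (D n).1) 0,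
    Set.subset_iUnion (fun n => (D n).2) 0, ?_⟩
  intro a ha b hb l m hl hm
  obtain ⟨n1, ha⟩ := Set.mem_iUnion.1 ha
  obtain ⟨n2, hb⟩ := Set.mem_iUnion.1 hb
  obtain ⟨n3, hl⟩ := hlist l hl
  obtain ⟨n4, hm⟩ := hlist m hm
  let n := max (max n1 n2) (max n3 n4)
  have hq : (a, l, m, b) ∈ Q (D n) :=
    ⟨hm1 (by grind : n1 ≤ n) ha, fun v hv => hm2 (by grind : n3 ≤ n) (hl v hv),
      fun v hv => hm2 (by grind : n4 ≤ n) (hm v hv), hm1 (by grind : n2 ≤ n) hb⟩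
  constructor
  · refine Set.Subset.trans ?_ (Set.subset_iUnion (fun n => (D n).1) (n + 1))
    exact Set.subset_union_of_subset_right
      (Set.subset_biUnion_of_mem (u := fun q => F q.1 q.2.1 q.2.2.1 q.2.2.2) hq) _
  · refine Set.Subset.trans ?_ (Set.subset_iUnion (fun n => (D n).2) (n + 1))
    exact Set.subset_union_of_subset_right
      (Set.subset_biUnion_of_mem (u := fun q => G q.1 q.2.1 q.2.2.1 q.2.2.2) hq) _

theorem exists_countable_witness {α : Type*} (P : α → Prop) :
    ∃ S : Set α, S.Countable ∧ ((∃ s, P s) → ∃ s ∈ S, P s) := by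
  by_cases h : ∃ s, P s
  · obtain ⟨s, hs⟩ := h
    exact ⟨{s}, Set.countable_singleton s, fun _ => ⟨s, rfl, hs⟩⟩
  · exact ⟨∅, Set.countable_empty, fun k => (h k).elim⟩

theorem Set.Countable.exists_nat_param {α : Type u} {S : Set α} (hS : S.Countable) :
    ∃ (N : Set ℕ) (φ : ULift.{u} N → α), Function.Injective φ ∧ Set.range φ = S := by
  obtain ⟨f, hf⟩ := hS.to_subtype.exists_injective_nat
  let e := Equiv.ofInjective f hf
  refine ⟨Set.range f, fun n => (e.symm n.down).1, fun m n h => ?_, ?_⟩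
  · exact ULift.down_injective (e.symm.injective (Subtype.val_injective h))
  · ext s
    constructor
    · rintro ⟨n, rfl⟩
      exact (e.symm n.down).2
    · exact fun hs => ⟨⟨e ⟨s, hs⟩⟩, by simp⟩

/-! ### Countable star-shaped parts and their codes -/

namespace WTS

variable {Lab : Type u}

/-- A path involves only finitely many states and actions. Quantifying over all larger `S` and `U`
lets the path survive the later closure process. -/
theorem exists_countable_path (E : WTS Lab) {e a : E.State} (h : E.Reachable e a) :
    ∃ (S₁ : Set E.State) (U₁ : Set E.Act), S₁.Countable ∧ U₁.Countable ∧
      ∀ S U, S₁ ⊆ S → U₁ ⊆ U → Relation.ReflTransGen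
        (fun s t => s ∈ S ∧ t ∈ S ∧ ∃ l, (∀ v ∈ l, v ∈ U) ∧ E.Trans s l t) e a := by
  induction h with
  | refl => exact ⟨∅, ∅, Set.countable_empty, Set.countable_empty, fun _ _ _ _ => .refl⟩
  | @tail b c _ h ih =>
    obtain ⟨S₁, U₁, hS, hU, ih⟩ := ih
    obtain ⟨l, h⟩ := h
    refine ⟨S₁ ∪ {b, c}, U₁ ∪ {v | v ∈ l}, hS.union (Set.toFinite _).countable,
      hU.union l.finite_toSet.countable, fun S U hSS hUU => ?_⟩
    exact (ih S U (Set.subset_union_left.trans hSS) (Set.subset_union_left.trans hUU)).tail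
      ⟨hSS (by simp), hSS (by simp), l, fun v hv => hUU (Or.inr hv), h⟩

/-- Countably many states and actions of `E` are contained in a countable part of `E` which is
closed enough for `E` and for the structure pulled back along a map `p`. -/
theorem exists_countable_part {E B : WTS Lab} (p : E ⟶ B) (hp : Function.Surjective p.onState)
    {e : E.State} (he : ∀ a, E.Reachable e a) {S₀ : Set E.State} {U₀ : Set E.Act}
    (hS₀ : S₀.Countable) (hU₀ : U₀.Countable) :
    ∃ (M N : Set ℕ) (φ : ULift.{u} M → E.State) (ψ : ULift.{u} N → E.Act) (s₀ : ULift.{u} M),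
      φ s₀ = e ∧ S₀ ⊆ Set.range φ ∧ U₀ ⊆ Set.range ψ ∧
      (∀ a, (E.pull φ ψ).Reachable s₀ a) ∧ (E.IsCubical → (E.pull φ ψ).IsCubical) ∧
      (E.IsCubical → B.IsCubical → (B.pull (p.onState ∘ φ) (p.onAct ∘ ψ)).IsCubical) := by
  -- The witnesses to close under: a path from `e` to `a`, an intermediate state for `E`, one for
  -- the structure pulled back from `B`, and the ends of some transition labelled by `l`, which is
  -- used for `l = [v]`.
  have key : ∀ (a : E.State) (l m : List E.Act) (b : E.State),
      ∃ (S₁ : Set E.State) (U₁ : Set E.Act), S₁.Countable ∧ U₁.Countable ∧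
        (∀ S U, S₁ ⊆ S → U₁ ⊆ U → Relation.ReflTransGen
          (fun s t => s ∈ S ∧ t ∈ S ∧ ∃ l, (∀ v ∈ l, v ∈ U) ∧ E.Trans s l t) e a) ∧
        ((∃ s, E.Trans a l s ∧ E.Trans s m b) → ∃ s ∈ S₁, E.Trans a l s ∧ E.Trans s m b) ∧
        ((∃ s, (B.pull p.onState p.onAct).Trans a l s ∧ (B.pull p.onState p.onAct).Trans s m b) →
          ∃ s ∈ S₁, (B.pull p.onState p.onAct).Trans a l s ∧
            (B.pull p.onState p.onAct).Trans s m b) ∧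
        ((∃ c d, E.Trans c l d) → ∃ c ∈ S₁, ∃ d ∈ S₁, E.Trans c l d) := by
    intro a l m b
    obtain ⟨S₁, U₁, hS, hU, h1⟩ := E.exists_countable_path (he a)
    obtain ⟨S₂, hS₂, h2⟩ := exists_countable_witness fun s => E.Trans a l s ∧ E.Trans s m b
    obtain ⟨S₃, hS₃, h3⟩ := exists_countable_witness fun s : E.State =>
      (B.pull p.onState p.onAct).Trans a l s ∧ (B.pull p.onState p.onAct).Trans s m b
    obtain ⟨S₄, hS₄, h4⟩ := exists_countable_witness fun q : E.State × E.State =>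
      E.Trans q.1 l q.2
    refine ⟨S₁ ∪ S₂ ∪ S₃ ∪ (Prod.fst '' S₄ ∪ Prod.snd '' S₄), U₁,
      ((hS.union hS₂).union hS₃).union ((hS₄.image _).union (hS₄.image _)), hU, ?_, ?_, ?_, ?_⟩
    · exact fun S U hSS hUU => h1 S U (fun x hx => hSS (by simp [hx])) hUU
    · intro h
      obtain ⟨s, hs, h⟩ := h2 h
      exact ⟨s, by simp [hs], h⟩
    · intro h
      obtain ⟨s, hs, h⟩ := h3 h
      exact ⟨s, Or.inl (Or.inr hs), h⟩
    · rintro ⟨c, d, h⟩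
      obtain ⟨q, hq, h⟩ := h4 ⟨(c, d), h⟩
      exact ⟨q.1, Or.inr (Or.inl ⟨q, hq, rfl⟩), q.2, Or.inr (Or.inr ⟨q, hq, rfl⟩), h⟩
  choose F G hF hG h1 h2 h3 h4 using key
  obtain ⟨S, U, hS, hU, hSS, hUU, hc⟩ := exists_countable_closed F G hF hG
    (hS₀.union (Set.countable_singleton e)) hU₀
  have heS : e ∈ S := hSS (Or.inr rfl)
  obtain ⟨M, φ, hφ, rfl⟩ := hS.exists_nat_param
  obtain ⟨N, ψ, hψ, rfl⟩ := hU.exists_nat_param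
  obtain ⟨s₀, rfl⟩ := heS
  have hl : ∀ l : List (ULift.{u} N), ∀ v ∈ l.map ψ, v ∈ Set.range ψ := by
    intro l v hv
    obtain ⟨w, -, rfl⟩ := List.mem_map.1 hv
    exact ⟨w, rfl⟩
  have hused : E.IsCubical → ∀ v, ∃ a b, E.Trans (φ a) [ψ v] (φ b) := by
    intro hE v
    obtain ⟨c, hc1, d, hd1, h⟩ := h4 (φ s₀) [ψ v] [] (φ s₀) (hE.act_used (ψ v))
    have hcl := (hc (φ s₀) ⟨s₀, rfl⟩ (φ s₀) ⟨s₀, rfl⟩ [ψ v] [] (hl [v]) (hl [])).1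
    obtain ⟨c, rfl⟩ := hcl hc1
    obtain ⟨d, rfl⟩ := hcl hd1
    exact ⟨c, d, h⟩
  refine ⟨M, N, φ, ψ, s₀, rfl, fun x hx => hSS (Or.inl hx), hUU, ?_, ?_, ?_⟩
  · intro a
    have hcl := hc (φ a) ⟨a, rfl⟩ (φ a) ⟨a, rfl⟩ [] [] (hl []) (hl [])
    exact pull_reachable hφ (h1 (φ a) [] [] (φ a) _ _ hcl.1 hcl.2) a rfl
  · intro hE
    refine pull_isCubical (hused hE) fun a l m b hl' hm h => ?_
    obtain ⟨s, hs, h⟩ := h2 (φ a) (l.map ψ) (m.map ψ) (φ b)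
      (hE.exists_mid (mt List.map_eq_nil_iff.1 hl') (mt List.map_eq_nil_iff.1 hm) h)
    obtain ⟨s, rfl⟩ := (hc (φ a) ⟨a, rfl⟩ (φ b) ⟨b, rfl⟩ _ _ (hl l) (hl m)).1 hs
    exact ⟨s, h⟩
  · intro hE hB
    refine pull_isCubical (fun v => ?_) fun a l m b hl' hm h => ?_
    · obtain ⟨a, b, h⟩ := hused hE v
      exact ⟨a, b, p.map_trans h⟩
    · obtain ⟨s, k1, k2⟩ :=
        hB.exists_mid (mt List.map_eq_nil_iff.1 hl') (mt List.map_eq_nil_iff.1 hm) h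
      -- Surjectivity on states turns the intermediate state of `B` into the image of a state of
      -- `E`, to which the closure applies.
      obtain ⟨s, rfl⟩ := hp s
      rw [← List.map_map] at k1 k2
      obtain ⟨s, hs, h1, h2⟩ := h3 (φ a) (l.map ψ) (m.map ψ) (φ b) ⟨s, k1, k2⟩
      obtain ⟨s, rfl⟩ := (hc (φ a) ⟨a, rfl⟩ (φ b) ⟨b, rfl⟩ _ _ (hl l) (hl m)).1 hs
      refine ⟨s, ?_, ?_⟩
      · rw [← List.map_map]
        exact h1
      · rw [← List.map_map]
        exact h2

/-- Weak transition systems whose states and actions are natural numbers. -/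
structure Code (Lab : Type u) where
  stateSet : Set ℕ
  actSet : Set ℕ
  label : ULift.{u} actSet → Lab
  Trans : ULift.{u} stateSet → List (ULift.{u} actSet) → ULift.{u} stateSet → Prop
  ne_nil : ∀ {a l b}, Trans a l b → l ≠ []
  perm : ∀ {a l l' b}, l.Perm l' → Trans a l b → Trans a l' b
  patch : ∀ {a x y z b s t}, x ≠ [] → y ≠ [] → z ≠ [] →
    Trans a (x ++ y ++ z) b → Trans a x s → Trans s (y ++ z) b →
    Trans a (x ++ y) t → Trans t z b → Trans s y t

/-- The transition system described by a code. -/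
def Code.toWTS (c : Code Lab) : WTS Lab where
  State := ULift.{u} c.stateSet
  Act := ULift.{u} c.actSet
  label := c.label
  Trans := c.Trans
  ne_nil := c.ne_nil
  perm := c.perm
  patch := c.patch

/-- The code of a pulled back structure. -/
def pullCode (X : WTS Lab) {M N : Set ℕ} (φ : ULift.{u} M → X.State) (ψ : ULift.{u} N → X.Act) :
    Code Lab where
  stateSet := M
  actSet := N
  label := (X.pull φ ψ).label
  Trans := (X.pull φ ψ).Trans
  ne_nil := (X.pull φ ψ).ne_nil
  perm := (X.pull φ ψ).perm
  patch := (X.pull φ ψ).patch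

/-- The codes of star-shaped systems. -/
structure StarCode (Lab : Type u) where
  code : Code Lab
  base : code.toWTS.State
  reachable : ∀ a, code.toWTS.Reachable base a

end WTS

/-! ### Detection of trivial fibrations by countable systems -/

namespace WTS

variable {Lab : Type u}

/-- A code of the one-state system. -/
def pointCode (Lab : Type u) : StarCode Lab where
  code :=
    { stateSet := {0}
      actSet := ∅
      label := fun v => v.down.2.elim
      Trans := fun _ _ _ => False
      ne_nil := fun h => h.elim
      perm := fun _ h => h
      patch := fun _ _ _ h => h.elim }
  base := ⟨⟨0, rfl⟩⟩
  reachable := by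
    rintro ⟨⟨_, rfl⟩⟩
    exact .refl

/-- The map from the coded one-state system which picks a state. -/
def fromPointCode (X : WTS Lab) (s : X.State) : (pointCode Lab).code.toWTS ⟶ X where
  onState _ := s
  onAct v := v.down.2.elim
  label_onAct v := v.down.2.elim
  map_trans h := h.elim

theorem fromPointCode_isInj (X : WTS Lab) (s : X.State) : IsInj (X.fromPointCode s) where
  state := by
    rintro ⟨⟨_, rfl⟩⟩ ⟨⟨_, rfl⟩⟩ _
    rfl
  act v := v.down.2.elim

theorem pointCode_isCubical : (pointCode Lab).code.toWTS.IsCubical :=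
  ⟨fun v => v.down.2.elim, fun _ _ h => h.elim⟩

/-- A based map between star-shaped systems is a trivial fibration as soon as it has the right
lifting property with respect to the injective based maps between coded systems. -/
theorem isTrivFib_of_lift {E B : WTS Lab} (p : E ⟶ B) (e : E.State)
    (hE : ∀ a, E.Reachable e a) (hB : ∀ b, B.Reachable (p.onState e) b)
    (hL : ∀ (c d : StarCode Lab) (g : c.code.toWTS ⟶ d.code.toWTS) (_ : IsInj g)
      (_ : g.onState c.base = d.base)
      (_ : E.IsCubical → B.IsCubical → c.code.toWTS.IsCubical ∧ d.code.toWTS.IsCubical)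
      (t : c.code.toWTS ⟶ E) (b : d.code.toWTS ⟶ B) (_ : t.onState c.base = e)
      (_ : b.onState d.base = p.onState e) (_ : t ≫ p = g ≫ b),
      ∃ k : d.code.toWTS ⟶ E, g ≫ k = t ∧ k ≫ p = b) : IsTrivFib p := by
  -- Lift the inclusion of a countable part of `B` against the inclusion of its base point.
  have hsurj : ∀ (S₀ : Set B.State) (U₀ : Set B.Act), S₀.Countable → U₀.Countable →
      S₀ ⊆ Set.range p.onState ∧ U₀ ⊆ Set.range p.onAct := by
    intro S₀ U₀ hS hU
    obtain ⟨M, N, φ, ψ, s₀, h0, hSS, hUU, hr, hc, -⟩ :=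
      exists_countable_part (𝟙 B) (fun b => ⟨b, rfl⟩) hB hS hU
    obtain ⟨k, -, hk⟩ := hL (pointCode Lab) ⟨B.pullCode φ ψ, s₀, hr⟩ (fromPointCode _ s₀)
      (fromPointCode_isInj _ _) rfl (fun _ h => ⟨pointCode_isCubical, hc h⟩) (fromPointCode _ e)
      (B.pullHom φ ψ) rfl h0 (hom_ext (fun _ => h0.symm) (fun v => v.down.2.elim))
    constructor
    · intro b hb
      obtain ⟨s, rfl⟩ := hSS hb
      exact ⟨k.onState s, congrArg (fun f : B.pull φ ψ ⟶ B => f.onState s) hk⟩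
    · intro v hv
      obtain ⟨w, rfl⟩ := hUU hv
      exact ⟨k.onAct w, congrArg (fun f : B.pull φ ψ ⟶ B => f.onAct w) hk⟩
  have hs : Function.Surjective p.onState := fun b =>
    (hsurj {b} ∅ (Set.countable_singleton b) Set.countable_empty).1 rfl
  refine ⟨hs, fun v => (hsurj ∅ {v} Set.countable_empty (Set.countable_singleton v)).2 rfl,
    fun {a l b} h => ?_⟩
  -- On a countable part containing `a`, `b` and `l`, compare the structures pulled back from `E`
  -- and from `B`. The comparison is the identity on carriers, so a lift must be the inclusion into
  -- `E`; that it is a map says that transitions of `B` are reflected.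
  obtain ⟨M, N, φ, ψ, s₀, h0, hSS, hUU, hr, hc, hc'⟩ := exists_countable_part p hs hE
    (S₀ := {a, b}) (U₀ := {v | v ∈ l}) (Set.toFinite _).countable l.finite_toSet.countable
  obtain ⟨k, hk, -⟩ := hL ⟨E.pullCode φ ψ, s₀, hr⟩
    ⟨B.pullCode (p.onState ∘ φ) (p.onAct ∘ ψ), s₀, fun a => (hr a).map (pullMap p φ ψ)⟩
    (pullMap p φ ψ) (pullMap_isInj p φ ψ) rfl (fun h1 h2 => ⟨hc h1, hc' h1 h2⟩) (E.pullHom φ ψ)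
    (B.pullHom (p.onState ∘ φ) (p.onAct ∘ ψ)) h0 (congrArg p.onState h0) rfl
  obtain ⟨a, rfl⟩ := hSS (Or.inl rfl : a ∈ _)
  obtain ⟨b, rfl⟩ := hSS (Or.inr rfl : b ∈ _)
  obtain ⟨l, rfl⟩ : l ∈ Set.range (List.map ψ) := by
    rw [Set.range_list_map]
    exact hUU
  have h' : (B.pull (p.onState ∘ φ) (p.onAct ∘ ψ)).Trans a l b := by
    rw [List.map_map] at h
    exact h
  have hkS : ∀ s : ULift.{u} M, k.onState s = φ s := fun s =>
    congrArg (fun f : E.pull φ ψ ⟶ E => f.onState s) hk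
  have hkA : l.map k.onAct = l.map ψ := List.map_congr_left fun v _ =>
    congrArg (fun f : E.pull φ ψ ⟶ E => f.onAct v) hk
  rw [← hkS a, ← hkS b, ← hkA]
  exact k.map_trans h'

end WTS

/-! ### Lifting in full subcategories of categories of objects under a given one -/

/-- A lift automatically commutes with the maps from `pt`, by its upper triangle. -/
theorem hasLiftingProperty_of_under {K : Type (u + 1)} [Category.{u} K] {pt : K}
    {P : ObjectProperty (Under pt)} {A B X Y : P.FullSubcategory} (g : A ⟶ B) (p : X ⟶ Y)
    (h : HasLiftingProperty g.hom.right p.hom.right) : HasLiftingProperty g p where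
  sq_hasLift {t b} sq := by
    have w : t.hom.right ≫ p.hom.right = g.hom.right ≫ b.hom.right :=
      congrArg (fun f : A ⟶ Y => f.hom.right) sq.w
    obtain ⟨⟨k, h1, h2⟩⟩ := (h.sq_hasLift ⟨w⟩)
    refine ⟨⟨ObjectProperty.homMk (Under.homMk k ?_), ?_, ?_⟩⟩
    · rw [← Under.w g.hom, Category.assoc, h1, Under.w]
    · exact ObjectProperty.hom_ext _ (Under.UnderMorphism.ext h1)
    · exact ObjectProperty.hom_ext _ (Under.UnderMorphism.ext h2)

/-- The maps of a class `C` between members of a family of objects. -/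
def mapsBetween {D : Type (u + 1)} [Category.{u} D] {I : Type u} (obj : I → D)
    (C : MorphismProperty D) : MorphismProperty D :=
  .ofHoms fun x : Σ i j : I, {f : obj i ⟶ obj j // C f} => x.2.2.1

instance {D : Type (u + 1)} [Category.{u} D] {I : Type u} (obj : I → D)
    (C : MorphismProperty D) : MorphismProperty.IsSmall.{u} (mapsBetween obj C) := by
  unfold mapsBetween
  infer_instance

theorem mapsBetween_mk {D : Type (u + 1)} [Category.{u} D] {I : Type u} (obj : I → D)
    (C : MorphismProperty D) {i j : I} (f : obj i ⟶ obj j) (hf : C f) : mapsBetween obj C f :=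
  .mk (⟨i, j, f, hf⟩ : Σ i j : I, {f : obj i ⟶ obj j // C f})

theorem mapsBetween_le {D : Type (u + 1)} [Category.{u} D] {I : Type u} (obj : I → D)
    (C : MorphismProperty D) : mapsBetween obj C ≤ C := by
  rintro _ _ _ ⟨i⟩
  exact i.2.2.2

/-- If `f` is in the left lifting class and factors as `i ≫ q` with `q` in the right lifting class,
then `f` is a first factor of `i`. -/
theorem exists_comp_eq_of_llp {D : Type (u + 1)} [Category.{u} D] {J : MorphismProperty D}
    {X Y W : D} {f : X ⟶ Y} (hf : J.rlp.llp f) {i : X ⟶ W} {q : W ⟶ Y} (hq : J.rlp q)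
    (h : i ≫ q = f) : ∃ k : Y ⟶ W, f ≫ k = i := by
  have := hf q hq
  have sq : CommSq i f q (𝟙 Y) := ⟨by simp [h]⟩
  exact ⟨sq.lift, sq.fac_left⟩

/-! ### Star-shaped weak transition systems -/

namespace WTS

variable {Lab : Type u}

/-- The star-shaped object given by a system and a state from which everything is reachable. -/
def star (X : WTS Lab) (x : X.State) (h : ∀ a, X.Reachable x a) :
    (starShaped Lab).FullSubcategory :=
  ⟨Under.mk (X.fromPoint x), h⟩

/-- The state picked by an object under the one-state system. -/
abbrev basePt (X : Under (point Lab)) : X.right.State := X.hom.onState PUnit.unit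

theorem onState_basePt {X Y : Under (point Lab)} (f : X ⟶ Y) :
    f.right.onState (basePt X) = basePt Y :=
  congrArg (fun g : point Lab ⟶ Y.right => g.onState PUnit.unit) (Under.w f)

/-- Maps of star-shaped objects are the maps of systems which preserve the base point. -/
def starHom {X Y : (starShaped Lab).FullSubcategory} (f : X.obj.right ⟶ Y.obj.right)
    (h : f.onState (basePt X.obj) = basePt Y.obj) : X ⟶ Y :=
  ObjectProperty.homMk (Under.homMk f (point_hom_ext h))

theorem starHom_ext {X Y : (starShaped Lab).FullSubcategory} {f g : X ⟶ Y}
    (h : f.hom.right = g.hom.right) : f = g :=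
  ObjectProperty.hom_ext _ (Under.UnderMorphism.ext h)

theorem underCofibrations_iff {X Y : (starShaped Lab).FullSubcategory} (f : X ⟶ Y) :
    underCofibrations (cofibrations Lab) (starShaped Lab) f ↔ IsInj f.hom.right :=
  mono_iff_isInj f.hom.right

/-- The star-shaped object of a code. -/
def StarCode.toStar (c : StarCode Lab) : (starShaped Lab).FullSubcategory :=
  c.code.toWTS.star c.base c.reachable

/-- The generating cofibrations of star-shaped weak transition systems. -/
def starGen (Lab : Type u) : MorphismProperty (starShaped Lab).FullSubcategory :=
  mapsBetween StarCode.toStar (underCofibrations (cofibrations Lab) (starShaped Lab))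

instance : MorphismProperty.IsSmall.{u} (starGen Lab) :=
  inferInstanceAs (MorphismProperty.IsSmall.{u} (mapsBetween _ _))

theorem starGen_le : starGen Lab ≤ underCofibrations (cofibrations Lab) (starShaped Lab) :=
  mapsBetween_le _ _

theorem isTrivFib_of_rlp {E B : (starShaped Lab).FullSubcategory} (p : E ⟶ B)
    (hp : (starGen Lab).rlp p) : IsTrivFib p.hom.right := by
  refine isTrivFib_of_lift p.hom.right (basePt E.obj) E.property ?_ ?_
  · rw [onState_basePt]
    exact B.property
  · intro c d g hg hg0 _ t b ht hb w
    let g' : c.toStar ⟶ d.toStar := starHom g hg0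
    have := hp g' (mapsBetween_mk _ _ g' ((underCofibrations_iff g').2 hg))
    have sq : CommSq (starHom t ht : c.toStar ⟶ E) g' p
        (starHom b (hb.trans (onState_basePt p.hom)) : d.toStar ⟶ B) := ⟨starHom_ext w⟩
    exact ⟨sq.lift.hom.right, congrArg (fun f : c.toStar ⟶ E => f.hom.right) sq.fac_left,
      congrArg (fun f : d.toStar ⟶ B => f.hom.right) sq.fac_right⟩

theorem isCofibrantlyGenerated (Lab : Type u) : IsCofibrantlyGeneratedClass
    (underCofibrations (cofibrations Lab) (starShaped Lab)) := by
  refine ⟨starGen Lab, inferInstance, le_antisymm ?_ ?_⟩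
  · intro X Y f hf E B p hp
    exact hasLiftingProperty_of_under _ _ ((isTrivFib_of_rlp p hp).hasLiftingProperty
      ((underCofibrations_iff f).1 hf))
  · intro X Y f hf
    obtain ⟨W, i, q, hfac, hi, hq, hW, -⟩ := exists_factorization f.hom.right
      (x₀ := basePt X.obj) X.property (by rw [onState_basePt]; exact Y.property)
    let i' : X ⟶ W.star _ hW := starHom i rfl
    let q' : W.star _ hW ⟶ Y := starHom q
      ((congrArg (fun k : X.obj.right ⟶ Y.obj.right => k.onState (basePt X.obj)) hfac).trans
        (onState_basePt f.hom))
    have hq' : (starGen Lab).rlp q' := fun _ _ g hg => hasLiftingProperty_of_under _ _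
      (hq.hasLiftingProperty ((underCofibrations_iff g).1 (starGen_le _ hg)))
    obtain ⟨k, hk⟩ := exists_comp_eq_of_llp hf hq' (starHom_ext hfac : i' ≫ q' = f)
    -- No full retract is needed: a first factor of an injective map is injective.
    rw [underCofibrations_iff]
    refine IsInj.of_comp (g := k.hom.right) ?_
    have e : f.hom.right ≫ k.hom.right = i :=
      congrArg (fun g : X ⟶ W.star _ hW => g.hom.right) hk
    rw [e]
    exact hi

end WTS

/-! ### Star-shaped cubical transition systems -/

namespace CTS

open WTS

variable {Lab : Type u}

/-- The star-shaped object given by a cubical system and a state from which everything is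
reachable. -/
def star (X : CTS Lab) (x : X.obj.State) (h : ∀ a, X.obj.Reachable x a) :
    (starShaped Lab).FullSubcategory :=
  ⟨Under.mk (ObjectProperty.homMk (X.obj.fromPoint x) : point Lab ⟶ X), h⟩

/-- The state picked by an object under the one-state system. -/
abbrev basePt (X : Under (point Lab)) : X.right.obj.State := X.hom.hom.onState PUnit.unit

theorem onState_basePt {X Y : Under (point Lab)} (f : X ⟶ Y) :
    f.right.hom.onState (basePt X) = basePt Y :=
  congrArg (fun g : point Lab ⟶ Y.right => g.hom.onState PUnit.unit) (Under.w f)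

/-- Maps of star-shaped objects are the maps of systems which preserve the base point. -/
def starHom {X Y : (starShaped Lab).FullSubcategory} (f : X.obj.right.obj ⟶ Y.obj.right.obj)
    (h : f.onState (basePt X.obj) = basePt Y.obj) : X ⟶ Y :=
  ObjectProperty.homMk (Under.homMk (ObjectProperty.homMk f)
    (ObjectProperty.hom_ext _ (point_hom_ext h)))

theorem starHom_ext {X Y : (starShaped Lab).FullSubcategory} {f g : X ⟶ Y}
    (h : f.hom.right.hom = g.hom.right.hom) : f = g :=
  ObjectProperty.hom_ext _ (Under.UnderMorphism.ext (ObjectProperty.hom_ext _ h))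

theorem cofibrations_iff {X Y : CTS Lab} (f : X ⟶ Y) : cofibrations Lab f ↔ IsInj f.hom :=
  mono_iff_isInj f.hom

theorem underCofibrations_iff {X Y : (starShaped Lab).FullSubcategory} (f : X ⟶ Y) :
    underCofibrations (cofibrations Lab) (starShaped Lab) f ↔ IsInj f.hom.right.hom :=
  mono_iff_isInj f.hom.right.hom

theorem hasLiftingProperty_of_hom {A B X Y : CTS Lab} (g : A ⟶ B) (p : X ⟶ Y)
    (h : HasLiftingProperty g.hom p.hom) : HasLiftingProperty g p where
  sq_hasLift {t b} sq := by
    have w : t.hom ≫ p.hom = g.hom ≫ b.hom := congrArg (fun f : A ⟶ Y => f.hom) sq.w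
    obtain ⟨⟨k, h1, h2⟩⟩ := (h.sq_hasLift ⟨w⟩)
    exact ⟨⟨ObjectProperty.homMk k, ObjectProperty.hom_ext _ h1, ObjectProperty.hom_ext _ h2⟩⟩

/-- The star-shaped object of a code of a cubical system. -/
def codeStar (c : {c : StarCode Lab // c.code.toWTS.IsCubical}) :
    (starShaped Lab).FullSubcategory :=
  star ⟨c.1.code.toWTS, c.2⟩ c.1.base c.1.reachable

/-- The generating cofibrations of star-shaped cubical transition systems. -/
def starGen (Lab : Type u) : MorphismProperty (starShaped Lab).FullSubcategory :=
  mapsBetween codeStar (underCofibrations (cofibrations Lab) (starShaped Lab))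

instance : MorphismProperty.IsSmall.{u} (starGen Lab) :=
  inferInstanceAs (MorphismProperty.IsSmall.{u} (mapsBetween _ _))

theorem starGen_le : starGen Lab ≤ underCofibrations (cofibrations Lab) (starShaped Lab) :=
  mapsBetween_le _ _

theorem isTrivFib_of_rlp {E B : (starShaped Lab).FullSubcategory} (p : E ⟶ B)
    (hp : (starGen Lab).rlp p) : IsTrivFib p.hom.right.hom := by
  refine isTrivFib_of_lift p.hom.right.hom (basePt E.obj) E.property ?_ ?_
  · rw [onState_basePt]
    exact B.property
  · intro c d g hg hg0 hcub t b ht hb w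
    obtain ⟨hc, hd⟩ := hcub E.obj.right.property B.obj.right.property
    let g' : codeStar ⟨c, hc⟩ ⟶ codeStar ⟨d, hd⟩ := starHom g hg0
    have := hp g' (mapsBetween_mk _ _ g' ((underCofibrations_iff g').2 hg))
    have sq : CommSq (starHom t ht : codeStar ⟨c, hc⟩ ⟶ E) g' p
        (starHom b (hb.trans (onState_basePt p.hom)) : codeStar ⟨d, hd⟩ ⟶ B) := ⟨starHom_ext w⟩
    exact ⟨sq.lift.hom.right.hom,
      congrArg (fun f : codeStar ⟨c, hc⟩ ⟶ E => f.hom.right.hom) sq.fac_left,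
      congrArg (fun f : codeStar ⟨d, hd⟩ ⟶ B => f.hom.right.hom) sq.fac_right⟩

theorem isCofibrantlyGenerated (Lab : Type u) : IsCofibrantlyGeneratedClass
    (underCofibrations (cofibrations Lab) (starShaped Lab)) := by
  refine ⟨starGen Lab, inferInstance, le_antisymm ?_ ?_⟩
  · intro X Y f hf E B p hp
    exact hasLiftingProperty_of_under _ _ (hasLiftingProperty_of_hom _ _
      ((isTrivFib_of_rlp p hp).hasLiftingProperty ((underCofibrations_iff f).1 hf)))
  · intro X Y f hf
    obtain ⟨W, i, q, hfac, hi, hq, hW, hc⟩ := exists_factorization f.hom.right.hom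
      (x₀ := basePt X.obj) X.property (by rw [onState_basePt]; exact Y.property)
    let W' : (starShaped Lab).FullSubcategory := star ⟨W, hc Y.obj.right.property⟩ _ hW
    let i' : X ⟶ W' := starHom i rfl
    let q' : W' ⟶ Y := starHom q ((congrArg (fun k : X.obj.right.obj ⟶ Y.obj.right.obj =>
      k.onState (basePt X.obj)) hfac).trans (onState_basePt f.hom))
    have hq' : (starGen Lab).rlp q' := fun _ _ g hg => hasLiftingProperty_of_under _ _
      (hasLiftingProperty_of_hom _ _
        (hq.hasLiftingProperty ((underCofibrations_iff g).1 (starGen_le _ hg))))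
    obtain ⟨k, hk⟩ := exists_comp_eq_of_llp hf hq' (starHom_ext hfac : i' ≫ q' = f)
    rw [underCofibrations_iff]
    refine IsInj.of_comp (g := k.hom.right.hom) ?_
    have e : f.hom.right.hom ≫ k.hom.right.hom = i :=
      congrArg (fun g : X ⟶ W' => g.hom.right.hom) hk
    rw [e]
    exact hi

end CTS

/-! ### Star-shaped regular transition systems -/

namespace RTS

open WTS

variable {Lab : Type u}

/-- The state picked by an object under the one-state system. -/
abbrev basePt (X : Under (point Lab)) : X.right.obj.obj.State :=
  X.hom.hom.hom.onState PUnit.unit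

theorem onState_basePt {X Y : Under (point Lab)} (f : X ⟶ Y) :
    f.right.hom.hom.onState (basePt X) = basePt Y :=
  congrArg (fun g : point Lab ⟶ Y.right => g.hom.hom.onState PUnit.unit) (Under.w f)

theorem hom_ext {X Y : RTS Lab} {f g : X ⟶ Y} (h : f.hom.hom = g.hom.hom) : f = g :=
  ObjectProperty.hom_ext _ (ObjectProperty.hom_ext _ h)

/-- The star-shaped object given by a regular system and a state from which everything is
reachable. -/
def star (X : RTS Lab) (x : X.obj.obj.State) (h : ∀ a, X.obj.obj.Reachable x a) :
    (starShaped Lab).FullSubcategory :=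
  ⟨Under.mk (ObjectProperty.homMk (ObjectProperty.homMk (X.obj.obj.fromPoint x)) :
    point Lab ⟶ X), h⟩

/-- Maps of star-shaped objects are the maps of systems which preserve the base point. -/
def starHom {X Y : (starShaped Lab).FullSubcategory} (f : X.obj.right ⟶ Y.obj.right)
    (h : f.hom.hom.onState (basePt X.obj) = basePt Y.obj) : X ⟶ Y :=
  ObjectProperty.homMk (Under.homMk f (hom_ext (point_hom_ext h)))

theorem starHom_ext {X Y : (starShaped Lab).FullSubcategory} {f g : X ⟶ Y}
    (h : f.hom.right = g.hom.right) : f = g :=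
  ObjectProperty.hom_ext _ (Under.UnderMorphism.ext h)

/-- The inclusion of star-shaped regular systems into star-shaped cubical systems. -/
def starToCTS (Lab : Type u) :
    (starShaped Lab).FullSubcategory ⥤ (CTS.starShaped Lab).FullSubcategory where
  obj X := CTS.star X.obj.right.obj (basePt X.obj) X.property
  map f := CTS.starHom f.hom.right.hom.hom (onState_basePt f.hom)

/-- The quotient map is surjective on states and carries paths to paths. -/
theorem reachable_regular (X : (CTS.starShaped Lab).FullSubcategory)
    (a : X.obj.right.regular.obj.obj.State) :
    X.obj.right.regular.obj.obj.Reachable (Quotient.mk _ (CTS.basePt X.obj)) a := by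
  induction a using Quotient.inductionOn with | _ a
  exact (X.property a).map X.obj.right.toRegQuot

/-- The reflection of a star-shaped cubical system. -/
def starRegular (X : (CTS.starShaped Lab).FullSubcategory) : (starShaped Lab).FullSubcategory :=
  star X.obj.right.regular _ (reachable_regular X)

/-- The universal property of the reflection of a star-shaped cubical system. -/
def starRegularEquiv (X : (CTS.starShaped Lab).FullSubcategory)
    (Z : (starShaped Lab).FullSubcategory) :
    (starRegular X ⟶ Z) ≃ (X ⟶ (starToCTS Lab).obj Z) where
  toFun g := CTS.starHom (X.obj.right.regularEquiv Z.obj.right g.hom.right).hom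
    (onState_basePt g.hom)
  invFun f := starHom ((X.obj.right.regularEquiv Z.obj.right).symm f.hom.right)
    (CTS.onState_basePt f.hom)
  left_inv g := starHom_ext
    ((X.obj.right.regularEquiv Z.obj.right).symm_apply_apply g.hom.right)
  right_inv _ := rfl

/-- The reflection of star-shaped cubical systems onto star-shaped regular ones. -/
def starReflection (Lab : Type u) :
    (CTS.starShaped Lab).FullSubcategory ⥤ (starShaped Lab).FullSubcategory :=
  Adjunction.leftAdjointOfEquiv (G := starToCTS Lab) (F_obj := starRegular) starRegularEquiv
    (fun _ _ _ _ _ => rfl)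

/-- The reflection of star-shaped systems is left adjoint to the inclusion. -/
def starReflectionAdj (Lab : Type u) : starReflection Lab ⊣ starToCTS Lab :=
  Adjunction.adjunctionOfEquivLeft _ _

/-- The generating cofibrations of star-shaped regular transition systems. -/
def starGen (Lab : Type u) : MorphismProperty (starShaped Lab).FullSubcategory :=
  .ofHoms fun f : Shrink.{u} (CTS.starGen Lab).toSet =>
    (starReflection Lab).map ((equivShrink _).symm f).1.hom

/-- Lifting problems transpose along `starReflectionAdj`. -/
theorem starGen_rlp_iff {E B : (starShaped Lab).FullSubcategory} (p : E ⟶ B) :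
    (starGen Lab).rlp p ↔ (CTS.starGen Lab).rlp ((starToCTS Lab).map p) := by
  constructor
  · intro hp X Y g hg
    rw [← (starReflectionAdj Lab).hasLiftingProperty_iff]
    let x : (CTS.starGen Lab).toSet := ⟨Arrow.mk g, hg⟩
    have h := hp _ (MorphismProperty.ofHoms.mk (f := fun f : Shrink.{u} (CTS.starGen Lab).toSet =>
      (starReflection Lab).map ((equivShrink _).symm f).1.hom) (equivShrink _ x))
    rw [Equiv.symm_apply_apply] at h
    exact h
  · rintro hp _ _ _ ⟨f⟩
    rw [(starReflectionAdj Lab).hasLiftingProperty_iff]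
    exact hp _ ((equivShrink _).symm f).2

instance : MorphismProperty.IsSmall.{u} (starGen Lab) := by
  unfold starGen
  infer_instance

/-- A map of regular systems lifts against the generating maps of `RTS.cofibrations` as soon as
it lifts against the cofibrations of cubical systems. -/
theorem map_reflection_rlp_iff {E B : RTS Lab} (p : E ⟶ B) :
    ((CTS.cofibrations Lab).map (CTS.reflection Lab)).rlp p ↔
      (CTS.cofibrations Lab).rlp p.hom := by
  constructor
  · intro hp X Y g hg
    have := hp _ (MorphismProperty.map_mem_map _ (CTS.reflection Lab) g hg)
    exact ((CTS.reflectionAdj Lab).hasLiftingProperty_iff g p).1 this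
  · rintro hp X Y f ⟨X', Y', g, hg, ⟨e⟩⟩
    have : HasLiftingProperty ((CTS.reflection Lab).map g) p :=
      ((CTS.reflectionAdj Lab).hasLiftingProperty_iff g p).2 (hp g hg)
    -- The image class `MorphismProperty.map` contains arrows merely isomorphic to a reflected
    -- cofibration.
    exact HasLiftingProperty.of_arrow_iso_left e p

/-- The reachable part of a regular system. -/
def reachStar (X : RTS Lab) (i : X.obj.obj.State) : (starShaped Lab).FullSubcategory :=
  star ⟨⟨X.obj.obj.reach i, reach_isCubical X.obj.property i⟩,
    reach_csa2 X.obj.property X.property i⟩ ⟨i, .refl⟩ (reach_reachable X.obj.property i)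

/-- The map induced on reachable parts. -/
def reachStarMap {X Y : RTS Lab} (f : X ⟶ Y) (i : X.obj.obj.State) :
    reachStar X i ⟶ reachStar Y (f.hom.hom.onState i) :=
  starHom (ObjectProperty.homMk (ObjectProperty.homMk (reachMap f.hom.hom rfl))) rfl

/-- Composing with the inclusions of the reachable parts gives a lifting problem against `p`. Its
solution preserves base points and has star-shaped source, so it factors through the reachable part;
the triangles commute because the inclusions are monic. -/
theorem reachStarMap_rlp {E B : RTS Lab} (p : E ⟶ B) (hp : (CTS.cofibrations Lab).rlp p.hom)
    (i : E.obj.obj.State) : (starGen Lab).rlp (reachStarMap p i) := by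
  rw [starGen_rlp_iff]
  intro X Y g hg
  have hg' : CTS.cofibrations Lab g.hom.right := CTS.starGen_le _ hg
  have := hp _ hg'
  refine ⟨fun {t b} sq => ?_⟩
  have w : t.hom.right.hom ≫ reachMap p.hom.hom rfl = g.hom.right.hom ≫ b.hom.right.hom :=
    congrArg (fun f : X ⟶ _ => f.hom.right.hom) sq.w
  have ht : t.hom.right.hom.onState (CTS.basePt X.obj) = ⟨i, .refl⟩ := CTS.onState_basePt t.hom
  have sq' : CommSq (ObjectProperty.homMk (t.hom.right.hom ≫ E.obj.obj.reachHom i) :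
      X.obj.right ⟶ E.obj) g.hom.right p.hom
      (ObjectProperty.homMk (b.hom.right.hom ≫ B.obj.obj.reachHom _)) :=
    ⟨ObjectProperty.hom_ext _ (congrArg (fun f => f ≫ B.obj.obj.reachHom _) w)⟩
  have hl : g.hom.right.hom ≫ sq'.lift.hom = t.hom.right.hom ≫ E.obj.obj.reachHom i :=
    congrArg (fun f : X.obj.right ⟶ E.obj => f.hom) sq'.fac_left
  have hr : sq'.lift.hom ≫ p.hom.hom = b.hom.right.hom ≫ B.obj.obj.reachHom _ :=
    congrArg (fun f : Y.obj.right ⟶ B.obj => f.hom) sq'.fac_right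
  have hk : sq'.lift.hom.onState (CTS.basePt Y.obj) = i := by
    rw [← CTS.onState_basePt g.hom, ← comp_onState, hl]
    exact congrArg Subtype.val ht
  refine ⟨⟨CTS.starHom (reachLift Y.obj.right.property Y.property sq'.lift.hom hk) ?_, ?_, ?_⟩⟩
  · exact Subtype.ext hk
  · refine CTS.starHom_ext ?_
    exact (reachHom_isInj E.obj.obj i).mono.right_cancellation _ _ hl
  · refine CTS.starHom_ext ?_
    exact (reachHom_isInj B.obj.obj (p.hom.hom.onState i)).mono.right_cancellation _ _ hr

theorem isCofibrantlyGenerated (Lab : Type u) : IsCofibrantlyGeneratedClass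
    (underCofibrations (cofibrations Lab) (starShaped Lab)) := by
  refine ⟨starGen Lab, inferInstance, le_antisymm ?_ ?_⟩
  · intro X Y f hf E B p hp
    refine hasLiftingProperty_of_under _ _ (hf _ ?_)
    rw [map_reflection_rlp_iff]
    have ht := CTS.isTrivFib_of_rlp _ ((starGen_rlp_iff p).1 hp)
    exact fun _ _ g hg => CTS.hasLiftingProperty_of_hom _ _
      (ht.hasLiftingProperty ((CTS.cofibrations_iff g).1 hg))
  · intro X Y f hf E B p hp
    rw [map_reflection_rlp_iff] at hp
    refine ⟨fun {t b} sq => ?_⟩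
    change X.obj.right ⟶ E at t
    change Y.obj.right ⟶ B at b
    have w : t ≫ p = f.hom.right ≫ b := sq.w
    have hw : b.hom.hom.onState (basePt Y.obj) =
        p.hom.hom.onState (t.hom.hom.onState (basePt X.obj)) := by
      rw [← onState_basePt f.hom]
      exact congrArg (fun k : X.obj.right ⟶ B => k.hom.hom.onState (basePt X.obj)) w.symm
    -- The objects `E` and `B` carry no base point; the square itself supplies one.
    let i := t.hom.hom.onState (basePt X.obj)
    have hq := hf _ (reachStarMap_rlp p hp i)
    let t' : X ⟶ reachStar E i := starHom (ObjectProperty.homMk (ObjectProperty.homMk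
      (reachLift X.obj.right.obj.property X.property t.hom.hom rfl))) rfl
    let b' : Y ⟶ reachStar B (p.hom.hom.onState i) :=
      starHom (ObjectProperty.homMk (ObjectProperty.homMk
        (reachLift Y.obj.right.obj.property Y.property b.hom.hom hw))) (Subtype.ext hw)
    have sq' : CommSq t' f (reachStarMap p i) b' := by
      refine ⟨starHom_ext (hom_ext ?_)⟩
      exact (reachHom_isInj B.obj.obj (p.hom.hom.onState i)).mono.right_cancellation _ _
        (congrArg (fun k : X.obj.right ⟶ B => k.hom.hom) w)
    have hl : f.hom.right.hom.hom ≫ sq'.lift.hom.right.hom.hom = t'.hom.right.hom.hom :=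
      congrArg (fun k : X ⟶ reachStar E i => k.hom.right.hom.hom) sq'.fac_left
    have hr : sq'.lift.hom.right.hom.hom ≫ reachMap p.hom.hom rfl = b'.hom.right.hom.hom :=
      congrArg (fun k : Y ⟶ reachStar B _ => k.hom.right.hom.hom) sq'.fac_right
    refine ⟨⟨ObjectProperty.homMk (ObjectProperty.homMk
      (sq'.lift.hom.right.hom.hom ≫ E.obj.obj.reachHom i)), hom_ext ?_, hom_ext ?_⟩⟩
    · exact congrArg (fun k : X.obj.right.obj.obj ⟶ E.obj.obj.reach i =>
        k ≫ E.obj.obj.reachHom i) hl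
    · exact congrArg (fun k : Y.obj.right.obj.obj ⟶ B.obj.obj.reach _ =>
        k ≫ B.obj.obj.reachHom _) hr

end RTS

theorem theorem5p8 (Lab : Type u) [Nonempty Lab] :
    IsCofibrantlyGeneratedClass
        (underCofibrations (WTS.cofibrations Lab) (WTS.starShaped Lab)) ∧
      IsCofibrantlyGeneratedClass
        (underCofibrations (CTS.cofibrations Lab) (CTS.starShaped Lab)) ∧
      IsCofibrantlyGeneratedClass
        (underCofibrations (RTS.cofibrations Lab) (RTS.starShaped Lab)) :=
  ⟨WTS.isCofibrantlyGenerated Lab, CTS.isCofibrantlyGenerated Lab, RTS.isCofibrantlyGenerated Lab⟩
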